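/- **Corollary 3.7 (Robinson stability from metric regularity).** Let $P$ be a topological space, let $g\colon P\times\mathbb R^n\to\mathbb R^l$, let $C\subset\mathbb R^l$ be closed (not necessarily convex), put $\Gamma(p):=\{x\in\mathbb R^n\mid g(p,x)\in C\}$ for $p\in P$, and let $(\bar p,\bar x)\in P\times\mathbb R^n$ satisfy $g(\bar p,\bar x)\in C$. Assume that there are neighborhoods $U_0$ of $\bar x$ and $V_0$ of $\bar p$ such that for each $p\in V_0$ the mapping $g(p,\cdot)$ is continuously differentiable on $U_0$, and that both $g$ and its partial derivative $\nabla_x g$ are continuous at $(\bar p,\bar x)$. Distances are Euclidean, with $\mathrm{dist}(\cdot\,;\emptyset):=\infty$. Suppose that the set-valued mapping $F(x):=g(\bar p,x)-C=\{g(\bar p,x)-c\mid c\in C\}$ is metrically regular around $(\bar x,0)$, i.e., there is $\kappa'\ge 0$ such that $$\mathrm{dist}\big(x;F^{-1}(y)\big)\le\kappa'\,\mathrm{dist}\big(y;F(x)\big)\quad\text{for all }(x,y)\text{ close to }(\bar x,0),$$ where $F^{-1}(y)=\{x\mid y\in F(x)\}$. Then the system $g(p,x)\in C$ enjoys Robinson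 stability at $(\bar p,\bar x)$: there are $\kappa\ge 0$ and neighborhoods $U$ of $\bar x$ and $V$ of $\bar p$ such that $$\mathrm{dist}\big(x;\Gamma(p)\big)\le\kappa\,\mathrm{dist}\big(g(p,x);C\big)\quad\text{for all }(p,x)\in V\times U.$$ -/

import Mathlib

open Set Filter Topology
open scoped NNReal ENNReal

namespace RobinsonStability

/-- The inverse `F⁻¹(y) = {z | y ∈ F z}` of a set-valued mapping `F : Z ⇉ Y`, written as a function
`Z → Set Y`. -/
def svInverse {Z Y : Type*} (F : Z → Set Y) (y : Y) : Set Z :=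
  {z | y ∈ F z}

/-- Metric regularity of a set-valued mapping `F : Z ⇉ Y` between metric spaces around a point
`(z₀, y₀)` of its graph: for some `κ ≥ 0`, `dist (z; F⁻¹(y)) ≤ κ dist (y; F(z))` for all `(z, y)`
close to `(z₀, y₀)`. Distances to sets take values in `[0, ∞]`, with `dist (· ; ∅) = ∞`. -/
def MetricallyRegularAround {Z Y : Type*} [MetricSpace Z] [MetricSpace Y]
    (F : Z → Set Y) (z₀ : Z) (y₀ : Y) : Prop :=
  ∃ κ : ℝ≥0, ∀ᶠ q : Z × Y in 𝓝 (z₀, y₀),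
    Metric.infEDist q.1 (svInverse F q.2) ≤ (κ : ℝ≥0∞) * Metric.infEDist q.2 (F q.1)

section System

variable {P : Type*} {n l : ℕ}

/-- The solution map `Γ(p) = {x | g(p, x) ∈ C}`. -/
def solutionMap (g : P → EuclideanSpace ℝ (Fin n) → EuclideanSpace ℝ (Fin l))
    (C : Set (EuclideanSpace ℝ (Fin l))) (p : P) : Set (EuclideanSpace ℝ (Fin n)) :=
  {x | g p x ∈ C}

/-- The set-valued mapping `x ↦ f(x) - C = {f(x) - c | c ∈ C}`. -/
def constraintMap (f : EuclideanSpace ℝ (Fin n) → EuclideanSpace ℝ (Fin l))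
    (C : Set (EuclideanSpace ℝ (Fin l))) (x : EuclideanSpace ℝ (Fin n)) :
    Set (EuclideanSpace ℝ (Fin l)) :=
  (fun c => f x - c) '' C

variable [TopologicalSpace P]

/-- The smoothness assumptions on `g` at `(p₀, x₀)`: there are neighborhoods `U` of `x₀` and `V`
of `p₀` such that `g(p, ·)` is continuously differentiable on `U` for each `p ∈ V`, and both `g` and
its partial derivative `∇ₓ g` are (jointly) continuous at `(p₀, x₀)`. -/
structure SmoothAtReference
    (g : P → EuclideanSpace ℝ (Fin n) → EuclideanSpace ℝ (Fin l))
    (p₀ : P) (x₀ : EuclideanSpace ℝ (Fin n)) : Prop where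
  contDiffOn : ∃ U : Set (EuclideanSpace ℝ (Fin n)), IsOpen U ∧ x₀ ∈ U ∧
    ∃ V ∈ 𝓝 p₀, ∀ p ∈ V, ContDiffOn ℝ 1 (g p) U
  continuousAt : ContinuousAt
    (fun q : P × EuclideanSpace ℝ (Fin n) => g q.1 q.2) (p₀, x₀)
  continuousAt_fderiv : ContinuousAt
    (fun q : P × EuclideanSpace ℝ (Fin n) => fderiv ℝ (g q.1) q.2) (p₀, x₀)

/-- Robinson stability of the system `g(p, x) ∈ C` at `(p₀, x₀)` with modulus `κ ≥ 0`: there are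
neighborhoods `U` of `x₀` and `V` of `p₀` with `dist (x; Γ(p)) ≤ κ dist (g(p, x); C)` for all
`(p, x) ∈ V × U`. Distances take values in `[0, ∞]`, so for nonempty `C` the estimate
contains the solvability `Γ(p) ≠ ∅` for all `p ∈ V`. -/
def RobinsonStableWith
    (g : P → EuclideanSpace ℝ (Fin n) → EuclideanSpace ℝ (Fin l))
    (C : Set (EuclideanSpace ℝ (Fin l)))
    (p₀ : P) (x₀ : EuclideanSpace ℝ (Fin n)) (κ : ℝ≥0) : Prop :=
  ∃ U ∈ 𝓝 x₀, ∃ V ∈ 𝓝 p₀, ∀ p ∈ V, ∀ x ∈ U,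
    Metric.infEDist x (solutionMap g C p) ≤ (κ : ℝ≥0∞) * Metric.infEDist (g p x) C

/-- Robinson stability of the system `g(p, x) ∈ C` at `(p₀, x₀)`, with some modulus `κ ≥ 0`. -/
def RobinsonStable
    (g : P → EuclideanSpace ℝ (Fin n) → EuclideanSpace ℝ (Fin l))
    (C : Set (EuclideanSpace ℝ (Fin l)))
    (p₀ : P) (x₀ : EuclideanSpace ℝ (Fin n)) : Prop :=
  ∃ κ : ℝ≥0, RobinsonStableWith g C p₀ x₀ κ

end System

end RobinsonStability

namespace RobinsonStability

/-! Put `h = g p - g p₀`, so that `g p z ∈ C` means `-h z ∈ F z`. Freeze the perturbation at the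
current point `y`: metric regularity of `F` at `(y, -h y)` gives `y'` with `g p₀ y' + h y ∈ C` and
`dist y y' ≤ K * dist (g p y; C)`. The new residual is at most `‖h y' - h y‖`. By the mean value
inequality (`SmoothAtReference.exists_uniform`), `h` is Lipschitz with constant `1 / (2 * K)` near
`x₀` for `p` near `p₀`, so the residual is halved. The resulting Newton-like iteration converges
geometrically to a point of `Γ(p)` (`exists_zero_of_halving`), with total length at most `2 * K`
times the initial residual. Convexity of `C` plays no role. -/

/-- A Lyusternik–Graves type iteration: if from each point `y` of a ball one can move by at most
`K * φ y` to a point where `φ` is halved, then `φ` has a zero close to the center. -/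
theorem exists_zero_of_halving {X : Type*} [MetricSpace X] [CompleteSpace X] {φ : X → ℝ}
    {x : X} {R K : ℝ} (hK : 0 ≤ K) (hφ : ∀ y, 0 ≤ φ y)
    (hcont : ∀ y ∈ Metric.ball x R, ContinuousAt φ y)
    (hstep : ∀ y ∈ Metric.ball x R, ∃ y', dist y y' ≤ K * φ y ∧
      (y' ∈ Metric.ball x R → φ y' ≤ φ y / 2))
    (hR : 2 * K * φ x < R) :
    ∃ z ∈ Metric.ball x R, φ z = 0 ∧ dist x z ≤ 2 * K * φ x := by
  have hstep' : ∀ y, ∃ y', y ∈ Metric.ball x R → dist y y' ≤ K * φ y ∧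
      (y' ∈ Metric.ball x R → φ y' ≤ φ y / 2) := by
    intro y
    by_cases hy : y ∈ Metric.ball x R
    · obtain ⟨y', h⟩ := hstep y hy
      exact ⟨y', fun _ => h⟩
    · exact ⟨y, fun h => absurd h hy⟩
  choose next hnext using hstep'
  set u : ℕ → X := fun k => next^[k] x with hu
  have hu0 : u 0 = x := rfl
  have husucc : ∀ k, u (k + 1) = next (u k) := fun k => Function.iterate_succ_apply' next k x
  have hKφ : 0 ≤ K * φ x := mul_nonneg hK (hφ x)
  -- The partial sums of the geometric series of step lengths stay below `2 * K * φ x < R`, so the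
  -- iterates never leave the ball.
  have mem_of_le : ∀ k : ℕ, ∀ y, dist x y ≤ 2 * K * φ x * (1 - (1 / 2) ^ k) →
      y ∈ Metric.ball x R := by
    intro k y hy
    have hk : (0 : ℝ) ≤ (1 / 2) ^ k := by positivity
    rw [Metric.mem_ball, dist_comm]
    nlinarith
  have inv : ∀ k, dist x (u k) ≤ 2 * K * φ x * (1 - (1 / 2) ^ k) ∧
      φ (u k) ≤ φ x * (1 / 2) ^ k := by
    intro k
    induction k with
    | zero => simp [hu0]
    | succ k ih =>
      obtain ⟨hd, hv⟩ := ih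
      obtain ⟨h1, h2⟩ := hnext (u k) (mem_of_le k _ hd)
      rw [← husucc] at h1 h2
      have hKv := mul_le_mul_of_nonneg_left hv hK
      have hd' : dist x (u (k + 1)) ≤ 2 * K * φ x * (1 - (1 / 2) ^ (k + 1)) := by
        have := dist_triangle x (u k) (u (k + 1))
        rw [pow_succ]
        linarith
      refine ⟨hd', ?_⟩
      have := h2 (mem_of_le _ _ hd')
      rw [pow_succ]
      linarith
  have hdist : ∀ k, dist (u k) (u (k + 1)) ≤ 2 * K * φ x / 2 / 2 ^ k := by
    intro k
    have h1 := (hnext (u k) (mem_of_le k _ (inv k).1)).1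
    rw [← husucc] at h1
    have hKv := mul_le_mul_of_nonneg_left (inv k).2 hK
    have : 2 * K * φ x / 2 / 2 ^ k = K * (φ x * (1 / 2) ^ k) := by
      rw [one_div, inv_pow]; ring
    linarith
  obtain ⟨z, hz⟩ := cauchySeq_tendsto_of_complete (cauchySeq_of_le_geometric_two hdist)
  have hxz : dist x z ≤ 2 * K * φ x := dist_le_of_le_geometric_two_of_tendsto₀ hdist hz
  have hzR : z ∈ Metric.ball x R := by
    rw [Metric.mem_ball, dist_comm]
    exact hxz.trans_lt hR
  refine ⟨z, hzR, le_antisymm ?_ (hφ z), hxz⟩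
  have hlim : Tendsto (fun k : ℕ => φ x * (1 / 2 : ℝ) ^ k) atTop (𝓝 (φ x * 0)) :=
    (tendsto_pow_atTop_nhds_zero_of_lt_one (by norm_num) (by norm_num)).const_mul _
  rw [mul_zero] at hlim
  exact le_of_tendsto_of_tendsto' ((hcont z hzR).tendsto.comp hz) hlim fun k => (inv k).2

/-- The distance of `y` to `f x - C` is the distance of `f x - y` to `C`. -/
theorem infEDist_constraintMap {n l : ℕ}
    (f : EuclideanSpace ℝ (Fin n) → EuclideanSpace ℝ (Fin l))
    (C : Set (EuclideanSpace ℝ (Fin l))) (x : EuclideanSpace ℝ (Fin n))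
    (y : EuclideanSpace ℝ (Fin l)) :
    Metric.infEDist y (constraintMap f C x) = Metric.infEDist (f x - y) C := by
  have h : Isometry fun c : EuclideanSpace ℝ (Fin l) => f x - c := by
    exact Isometry.of_dist_eq fun a b => dist_sub_left (f x) a b
  have := Metric.infEDist_image (x := f x - y) (t := C) h
  simpa [constraintMap] using this

theorem mem_svInverse_constraintMap {n l : ℕ}
    {f : EuclideanSpace ℝ (Fin n) → EuclideanSpace ℝ (Fin l)}
    {C : Set (EuclideanSpace ℝ (Fin l))} {x : EuclideanSpace ℝ (Fin n)}
    {y : EuclideanSpace ℝ (Fin l)} :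
    x ∈ svInverse (constraintMap f C) y ↔ f x - y ∈ C := by
  constructor
  · rintro ⟨c, hc, h⟩
    rw [← h]
    simpa using hc
  · exact fun h => ⟨f x - y, h, by simp⟩

/-- The metric regularity estimate at `(x, y)` yields a point of `F⁻¹(y)` whose distance to `x` is
controlled with any larger modulus. -/
theorem exists_mem_of_regularity_estimate {n l : ℕ}
    {f : EuclideanSpace ℝ (Fin n) → EuclideanSpace ℝ (Fin l)}
    {C : Set (EuclideanSpace ℝ (Fin l))} (hC : IsClosed C) (hne : C.Nonempty)
    {κ : ℝ≥0} {x : EuclideanSpace ℝ (Fin n)} {y : EuclideanSpace ℝ (Fin l)}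
    (h : Metric.infEDist x (svInverse (constraintMap f C) y) ≤
      (κ : ℝ≥0∞) * Metric.infEDist y (constraintMap f C x)) :
    ∃ x', f x' - y ∈ C ∧ dist x x' ≤ (κ + 1) * Metric.infDist (f x - y) C := by
  rcases (Metric.infDist_nonneg (x := f x - y) (s := C)).eq_or_lt with h0 | hpos
  -- At zero residual the larger modulus gives no slack; closedness of `C` makes `x` itself a
  -- solution.
  · exact ⟨x, (hC.mem_iff_infDist_zero hne).2 h0.symm, by simp [← h0]⟩
  · have hlt : Metric.infEDist x (svInverse (constraintMap f C) y) <
        ENNReal.ofReal ((κ + 1) * Metric.infDist (f x - y) C) := by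
      refine h.trans_lt ?_
      rw [infEDist_constraintMap, ← ENNReal.ofReal_toReal (Metric.infEDist_ne_top hne),
        ← ENNReal.ofReal_coe_nnreal, ← ENNReal.ofReal_mul κ.coe_nonneg]
      change ENNReal.ofReal (κ * Metric.infDist (f x - y) C) < _
      refine (ENNReal.ofReal_lt_ofReal_iff (by positivity)).2 ?_
      nlinarith
    obtain ⟨x', hx', hd⟩ := Metric.infEDist_lt_iff.1 hlt
    refine ⟨x', mem_svInverse_constraintMap.1 hx', ?_⟩
    rw [edist_dist] at hd
    exact (ENNReal.ofReal_lt_ofReal_iff (by positivity)).1 hd |>.le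

/-- Under the smoothness assumptions, the perturbations `g p - g p₀` are eventually uniformly small
and Lipschitz with an arbitrarily small constant near `x₀`. -/
theorem SmoothAtReference.exists_uniform {P : Type*} [TopologicalSpace P] {n l : ℕ}
    {g : P → EuclideanSpace ℝ (Fin n) → EuclideanSpace ℝ (Fin l)}
    {p₀ : P} {x₀ : EuclideanSpace ℝ (Fin n)} (hg : SmoothAtReference g p₀ x₀)
    {η ε : ℝ} (hη : 0 < η) (hε : 0 < ε) :
    ∃ r > 0, ∃ V ∈ 𝓝 p₀, ∀ p ∈ V,
      (∀ x ∈ Metric.ball x₀ r, ContinuousAt (g p) x) ∧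
      (∀ x ∈ Metric.ball x₀ r, ‖g p x - g p₀ x‖ < η) ∧
      ∀ x ∈ Metric.ball x₀ r, ∀ x' ∈ Metric.ball x₀ r,
        ‖(g p x' - g p₀ x') - (g p x - g p₀ x)‖ ≤ ε * ‖x' - x‖ := by
  obtain ⟨U, hUo, hxU, V₀, hV₀, hsm⟩ := hg.contDiffOn
  -- Halves, because the values for `p` and for `p₀` at the same point are both compared with the
  -- value at `(p₀, x₀)`.
  have e1 := Metric.continuousAt_iff'.1 hg.continuousAt (η / 2) (half_pos hη)
  have e2 := Metric.continuousAt_iff'.1 hg.continuousAt_fderiv (ε / 2) (half_pos hε)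
  obtain ⟨V₁, hV₁, W, hW, hVW⟩ := mem_nhds_prod_iff.1 (e1.and e2)
  obtain ⟨r, hr, hball⟩ := Metric.mem_nhds_iff.1 (inter_mem hW (hUo.mem_nhds hxU))
  have hp₀ : p₀ ∈ V₀ := mem_of_mem_nhds hV₀
  have hp₁ : p₀ ∈ V₁ := mem_of_mem_nhds hV₁
  have hdiff : ∀ p ∈ V₀, ∀ x ∈ Metric.ball x₀ r, DifferentiableAt ℝ (g p) x :=
    fun p hp x hx => ((hsm p hp).contDiffAt (hUo.mem_nhds (hball hx).2)).differentiableAt (by simp)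
  refine ⟨r, hr, V₀ ∩ V₁, inter_mem hV₀ hV₁, fun p hp =>
    ⟨fun x hx => (hdiff p hp.1 x hx).continuousAt, fun x hx => ?_, fun x hx x' hx' => ?_⟩⟩
  · have a := (hVW (mk_mem_prod hp.2 (hball hx).1)).1
    have b := (hVW (mk_mem_prod hp₁ (hball hx).1)).1
    rw [← dist_eq_norm]
    have := dist_triangle_right (g p x) (g p₀ x) (g p₀ x₀)
    simp only at a b
    linarith
  · refine (convex_ball x₀ r).norm_image_sub_le_of_norm_fderiv_le (𝕜 := ℝ)
      (f := fun z => g p z - g p₀ z)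
      (fun z hz => (hdiff p hp.1 z hz).sub (hdiff p₀ hp₀ z hz)) (fun z hz => ?_) hx hx'
    have a := (hVW (mk_mem_prod hp.2 (hball hz).1)).2
    have b := (hVW (mk_mem_prod hp₁ (hball hz).1)).2
    rw [fderiv_fun_sub (hdiff p hp.1 z hz) (hdiff p₀ hp₀ z hz), ← dist_eq_norm]
    have := dist_triangle_right (fderiv ℝ (g p) z) (fderiv ℝ (g p₀) z) (fderiv ℝ (g p₀) x₀)
    simp only at a b
    linarith

end RobinsonStability

theorem corollary3p7 {P : Type*} [TopologicalSpace P] {n l : ℕ}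
    (g : P → EuclideanSpace ℝ (Fin n) → EuclideanSpace ℝ (Fin l))
    (C : Set (EuclideanSpace ℝ (Fin l))) (hC : IsClosed C)
    (p₀ : P) (x₀ : EuclideanSpace ℝ (Fin n))
    (hfeas : x₀ ∈ RobinsonStability.solutionMap g C p₀)
    (hg : RobinsonStability.SmoothAtReference g p₀ x₀)
    (hreg : RobinsonStability.MetricallyRegularAround
      (RobinsonStability.constraintMap (g p₀) C) x₀ 0) :
    RobinsonStability.RobinsonStable g C p₀ x₀ := by
  -- Needed for `infDist` to agree with `infEDist`: the real-valued distance to `∅` is `0`.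
  have hne : C.Nonempty := ⟨_, hfeas⟩
  obtain ⟨κ, hκ⟩ := hreg
  obtain ⟨δ, hδ, hreg⟩ := Metric.eventually_nhds_iff.1 hκ
  set K : ℝ := κ + 1 with hK
  have hKpos : 0 < K := by positivity
  -- The bound `δ` keeps `-h y` in the range of the regularity estimate; the constant `1 / (2 * K)`
  -- times a step of length `K * residual` is half the residual.
  obtain ⟨r', hr', V₁, hV₁, hunif⟩ := hg.exists_uniform hδ (ε := 1 / (2 * K)) (by positivity)
  set r := min r' δ with hrdef
  have hr : 0 < r := lt_min hr' hδ
  have hrr' : Metric.ball x₀ r ⊆ Metric.ball x₀ r' := Metric.ball_subset_ball (min_le_left _ _)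
  -- Makes the whole iteration path, of length at most `2 * K * residual`, shorter than `r / 2`.
  have hsmall := Metric.continuousAt_iff'.1 hg.continuousAt (r / 2 / (2 * K)) (by positivity)
  obtain ⟨V₂, hV₂, W, hW, hVW⟩ := mem_nhds_prod_iff.1 hsmall
  refine ⟨⟨2 * K, by positivity⟩, W ∩ Metric.ball x₀ (r / 2),
    inter_mem hW (Metric.ball_mem_nhds _ (half_pos hr)), V₁ ∩ V₂, inter_mem hV₁ hV₂, ?_⟩
  rintro p ⟨hp₁, hp₂⟩ x ⟨hxW, hxr⟩
  obtain ⟨hcont, hbd, hlip⟩ := hunif p hp₁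
  have hsub : Metric.ball x (r / 2) ⊆ Metric.ball x₀ r := by
    refine Metric.ball_subset_ball' ?_
    have := Metric.mem_ball.1 hxr
    linarith
  have hφx : 2 * K * Metric.infDist (g p x) C < r / 2 := by
    have h1 : Metric.infDist (g p x) C ≤ dist (g p x) (g p₀ x₀) :=
      Metric.infDist_le_dist_of_mem hfeas
    have hmem : (p, x) ∈ V₂ ×ˢ W := ⟨hp₂, hxW⟩
    have h2 := hVW hmem
    simp only [mem_ofPred_eq] at h2
    rw [mul_comm]
    exact (lt_div_iff₀ (by positivity)).1 (h1.trans_lt h2)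
  have hstep : ∀ y ∈ Metric.ball x (r / 2), ∃ y', dist y y' ≤ K * Metric.infDist (g p y) C ∧
      (y' ∈ Metric.ball x (r / 2) →
        Metric.infDist (g p y') C ≤ Metric.infDist (g p y) C / 2) := by
    intro y hy
    have hy' := hsub hy
    have hnear : dist (y, -(g p y - g p₀ y)) (x₀, (0 : EuclideanSpace ℝ (Fin l))) < δ := by
      rw [Prod.dist_eq]
      refine max_lt ((Metric.mem_ball.1 hy').trans_le (min_le_right _ _)) ?_
      simpa only [dist_zero_right, norm_neg] using hbd y (hrr' hy')
    obtain ⟨y', hy'C, hd⟩ :=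
      RobinsonStability.exists_mem_of_regularity_estimate hC hne (hreg hnear)
    have hgy : g p₀ y - -(g p y - g p₀ y) = g p y := by abel
    rw [hgy] at hd
    refine ⟨y', hd, fun hmem => ?_⟩
    have h1 := Metric.infDist_le_dist_of_mem (x := g p y') hy'C
    have h2 := hlip y (hrr' hy') y' (hrr' (hsub hmem))
    have h3 : dist (g p y') (g p₀ y' - -(g p y - g p₀ y)) =
        ‖(g p y' - g p₀ y') - (g p y - g p₀ y)‖ := by
      rw [dist_eq_norm]; congr 1; abel
    rw [← dist_eq_norm y' y, dist_comm y' y] at h2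
    calc Metric.infDist (g p y') C ≤ 1 / (2 * K) * dist y y' := by
          rw [h3] at h1; exact h1.trans h2
      _ ≤ 1 / (2 * K) * (K * Metric.infDist (g p y) C) := by gcongr
      _ = Metric.infDist (g p y) C / 2 := by field_simp
  obtain ⟨z, -, hz0, hxz⟩ := RobinsonStability.exists_zero_of_halving
    (φ := fun y => Metric.infDist (g p y) C) (x := x) (R := r / 2) hKpos.le
    (fun y => Metric.infDist_nonneg)
    (fun y hy => (Metric.continuous_infDist_pt C).continuousAt.comp (hcont y (hrr' (hsub hy))))
    hstep hφx
  have hzΓ : z ∈ RobinsonStability.solutionMap g C p := (hC.mem_iff_infDist_zero hne).2 hz0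
  calc Metric.infEDist x (RobinsonStability.solutionMap g C p) ≤ edist x z :=
        Metric.infEDist_le_edist_of_mem hzΓ
    _ ≤ ENNReal.ofReal (2 * K * Metric.infDist (g p x) C) := by
        rw [edist_dist]; exact ENNReal.ofReal_le_ofReal hxz
    _ = _ := by
        rw [ENNReal.ofReal_mul (by positivity), Metric.infDist,
          ENNReal.ofReal_toReal (Metric.infEDist_ne_top hne)]
        congr 1
        exact ENNReal.ofReal_eq_coe_nnreal (by positivity)
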